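/- All locally compact groups are assumed to be Hausdorff. A topological group is compactly generated if it is generated, as a group, by some compact subset. Isomorphisms are isomorphisms of topological groups. Semidirect products carry the product topology. Theorem. There exists a second countable (hence $\sigma$-compact) locally compact group $H$ that is isomorphic to a closed subgroup of some compactly generated locally compact group, but is not isomorphic to any open subgroup of any compactly generated locally compact group. Moreover, each of the following three choices is possible for such an $H$: 1. $H = K \rtimes \Gamma$ with $K$ a compact connected abelian group and $\Gamma$ a discrete abelian group; 2. $H = K \rtimes \Gamma$ with $K$ a profinite abelian group and $\Gamma$ a discrete abelian group; 3. $H$ is a (finite-dimensional real) Lie group, of the form $H = \mathbf{R} \rtimes \Lambda$, where $\Lambda$ is a subgroup of $\mathbf{R}^\times$ endowed with the discrete topology and acting on $\mathbf{R}$ by multiplication. -/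

import Mathlib

open scoped ContDiff Manifold

universe u

/-- A locally compact group: a locally compact Hausdorff topological group. -/
structure IsLCGroup (G : Type u) [Group G] [TopologicalSpace G] : Prop where
  isTopologicalGroup : IsTopologicalGroup G
  t2Space : T2Space G
  locallyCompactSpace : LocallyCompactSpace G

/-- A topological group is compactly generated if some compact subset generates it as a group. -/
def IsCompactlyGeneratedGroup (G : Type u) [Group G] [TopologicalSpace G] : Prop :=
  ∃ S : Set G, IsCompact S ∧ Subgroup.closure S = ⊤

/-- `H` is isomorphic, as a topological group, to a closed subgroup of `G`. -/
def IsIsoToClosedSubgroup (H : Type) [Group H] [TopologicalSpace H]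
    (G : Type u) [Group G] [TopologicalSpace G] : Prop :=
  ∃ S : Subgroup G, IsClosed (S : Set G) ∧ Nonempty (H ≃ₜ* S)

/-- `H` is isomorphic, as a topological group, to an open subgroup of `G`. -/
def IsIsoToOpenSubgroup (H : Type) [Group H] [TopologicalSpace H]
    (G : Type u) [Group G] [TopologicalSpace G] : Prop :=
  ∃ S : Subgroup G, IsOpen (S : Set G) ∧ Nonempty (H ≃ₜ* S)

/-- `H` is a second countable locally compact group (in particular `σ`-compact) that is isomorphic
to a closed subgroup of some compactly generated locally compact group, but not to any open
subgroup of any compactly generated locally compact group. The universe of the groups in the last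
condition is arbitrary. -/
structure EmbedsClosedNotOpen (H : Type) [Group H] [TopologicalSpace H] : Prop where
  isLCGroup : IsLCGroup H
  secondCountable : SecondCountableTopology H
  sigmaCompact : SigmaCompactSpace H
  closed : ∃ (G : Type) (_ : Group G) (_ : TopologicalSpace G),
    IsLCGroup G ∧ IsCompactlyGeneratedGroup G ∧ IsIsoToClosedSubgroup H G
  not_open : ∀ (G : Type u) [Group G] [TopologicalSpace G],
    IsLCGroup G → IsCompactlyGeneratedGroup G → ¬ IsIsoToOpenSubgroup H G

/-- The product topology on a semidirect product. -/
instance SemidirectProduct.instProdTopology {N G : Type*} [Group N] [Group G]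
    [TopologicalSpace N] [TopologicalSpace G] (φ : G →* MulAut N) :
    TopologicalSpace (SemidirectProduct N G φ) :=
  TopologicalSpace.induced SemidirectProduct.equivProd inferInstance

/-- A (finite-dimensional, real) Lie group: the topological group `G` carries a smooth atlas for
which multiplication and inversion are smooth. -/
def IsRealLieGroup (G : Type) [Group G] [TopologicalSpace G] : Prop :=
  ∃ (E : Type) (_ : NormedAddCommGroup E) (_ : NormedSpace ℝ E) (_ : FiniteDimensional ℝ E)
    (_ : ChartedSpace E G), LieGroup 𝓘(ℝ, E) ∞ G

/-- The action of a group `Λ` on the additive group of real numbers (written multiplicatively)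
in which `a` acts as multiplication by the nonzero real number `χ a`. -/
noncomputable def realScaling {Λ : Type} [Group Λ] (χ : Λ →* ℝˣ) :
    Λ →* MulAut (Multiplicative ℝ) where
  toFun a :=
    { toFun := fun x => Multiplicative.ofAdd ((χ a : ℝ) * x.toAdd)
      invFun := fun x => Multiplicative.ofAdd (((χ a)⁻¹ : ℝˣ) * x.toAdd)
      left_inv := fun x => by simp
      right_inv := fun x => by simp
      map_mul' := fun x y => by simp [mul_add] }
  map_one' := by ext x; simp
  map_mul' a b := by ext x; simp [mul_assoc]

/-! Each `H` is `K ⋊ Γ` with `Γ = FreeAbZ` free abelian of countably infinite rank, mapped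
injectively to nonzero rationals by sending a basis to distinct odd primes.

Obstruction (`not_isIsoToOpenSubgroup`): suppose `H` is open in a compactly generated `G`. Since `Γ`
is discrete, `K` is open in `G`. Each `K` carries a germ at `0` of a one-parameter subgroup `L : F →
K` over a topological field `F`, and conjugation by any `g : G` turns `L x` into `L (c * x)` for
small `x`. The scalar `c` is unique, so it defines a homomorphism `G →* Fˣ`. It kills the
commutative open subgroup `K`, hence its image is finitely generated by compactness. But on `Γ` it
is the faithful scaling character, so `Γ` would embed in a finitely generated abelian group, which
is absurd.

Closed embedding: `Γ` lies in the finitely generated group `ℤ ≀ ℤ`. If `K` is compact, it embeds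
equivariantly in a compact coinduced group inside `D → K`, with `D = ℤ ≀ ℤ`, and the semidirect
product of that group with `D` is compactly generated. For `K = ℝ` the action extends to `ℝ × (ℤ ≀
ℤ)` through the exponential of the first factor, and `Γ` sits diagonally in it.

The three kernels are the dual of `ℚ` with its dense line (`F = ℝ`), `ℤ_2` (`F = ℚ_2`), and `ℝ`
itself. -/

open Topology Filter

/-! ### Topological semidirect products -/

namespace SemidirectProduct

variable {N E : Type*} [Group N] [Group E] [TopologicalSpace N] [TopologicalSpace E]
  {φ : E →* MulAut N}

/-- The underlying space of a semidirect product is the product space. -/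
def homeomorphProd (φ : E →* MulAut N) : SemidirectProduct N E φ ≃ₜ N × E :=
  equivProd.toHomeomorphOfIsInducing ⟨rfl⟩

lemma continuous_left : Continuous (fun x : SemidirectProduct N E φ => x.left) :=
  continuous_fst.comp (homeomorphProd φ).continuous

lemma continuous_right : Continuous (fun x : SemidirectProduct N E φ => x.right) :=
  continuous_snd.comp (homeomorphProd φ).continuous

lemma continuous_of_left_right {X : Type*} [TopologicalSpace X]
    {f : X → SemidirectProduct N E φ} (hl : Continuous fun x => (f x).left)
    (hr : Continuous fun x => (f x).right) : Continuous f :=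
  continuous_induced_rng.2 (hl.prodMk hr)

lemma continuous_inl : Continuous (inl : N →* SemidirectProduct N E φ) :=
  continuous_of_left_right continuous_id continuous_const

lemma continuous_inr : Continuous (inr : E →* SemidirectProduct N E φ) :=
  continuous_of_left_right continuous_const continuous_id

lemma isTopologicalGroup [IsTopologicalGroup N] [IsTopologicalGroup E]
    (hφ : Continuous fun p : E × N => φ p.1 p.2) :
    IsTopologicalGroup (SemidirectProduct N E φ) where
  continuous_mul := continuous_of_left_right
    ((continuous_left.comp continuous_fst).mul (hφ.comp
      ((continuous_right.comp continuous_fst).prodMk (continuous_left.comp continuous_snd))))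
    ((continuous_right.comp continuous_fst).mul (continuous_right.comp continuous_snd))
  continuous_inv := continuous_of_left_right
    (hφ.comp (continuous_right.inv.prodMk continuous_left.inv)) continuous_right.inv

lemma isLCGroup (hN : IsLCGroup N) (hE : IsLCGroup E)
    (hφ : Continuous fun p : E × N => φ p.1 p.2) : IsLCGroup (SemidirectProduct N E φ) := by
  have := hN.isTopologicalGroup
  have := hE.isTopologicalGroup
  have := hN.t2Space
  have := hE.t2Space
  have := hN.locallyCompactSpace
  have := hE.locallyCompactSpace
  exact ⟨isTopologicalGroup hφ, (homeomorphProd φ).symm.t2Space,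
    (homeomorphProd φ).isClosedEmbedding.locallyCompactSpace⟩

lemma isCompactlyGeneratedGroup (hN : IsCompactlyGeneratedGroup N)
    (hE : IsCompactlyGeneratedGroup E) :
    IsCompactlyGeneratedGroup (SemidirectProduct N E φ) := by
  obtain ⟨S, hS, hSN⟩ := hN
  obtain ⟨T, hT, hTE⟩ := hE
  refine ⟨inl '' S ∪ inr '' T, (hS.image continuous_inl).union (hT.image continuous_inr),
    eq_top_iff.2 fun x _ => ?_⟩
  rw [Subgroup.closure_union, ← MonoidHom.map_closure, ← MonoidHom.map_closure, hSN, hTE,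
    ← inl_left_mul_inr_right x]
  exact Subgroup.mul_mem_sup ⟨_, trivial, rfl⟩ ⟨_, trivial, rfl⟩

lemma isClosedEmbedding_map {K Γ : Type*} [Group K] [Group Γ] [TopologicalSpace K]
    [TopologicalSpace Γ] {ψ : Γ →* MulAut K} {i : K →* N} {j : Γ →* E}
    (hi : IsClosedEmbedding i) (hj : IsClosedEmbedding j)
    (h : ∀ γ, i.comp (ψ γ).toMonoidHom = (φ (j γ)).toMonoidHom.comp i) :
    IsClosedEmbedding (map i j h) :=
  (homeomorphProd φ).symm.isClosedEmbedding.comp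
    ((hi.prodMap hj).comp (homeomorphProd ψ).isClosedEmbedding)

end SemidirectProduct

lemma IsIsoToClosedSubgroup.of_isClosedEmbedding {H : Type} [Group H] [TopologicalSpace H]
    {G : Type*} [Group G] [TopologicalSpace G] (f : H →* G) (hf : IsClosedEmbedding f) :
    IsIsoToClosedSubgroup H G := by
  refine ⟨f.range, by simpa using hf.isClosed_range, ⟨?_⟩⟩
  exact
    { MonoidHom.ofInjective hf.injective with
      continuous_toFun := hf.continuous.subtype_mk _
      continuous_invFun := hf.isInducing.continuous_iff.2 <| by
        convert continuous_subtype_val using 1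
        ext x
        exact congrArg Subtype.val ((MonoidHom.ofInjective hf.injective).apply_symm_apply x) }

lemma continuous_prod_of_discrete {X Y Z : Type*} [TopologicalSpace X] [DiscreteTopology X]
    [TopologicalSpace Y] [TopologicalSpace Z] {f : X × Y → Z}
    (hf : ∀ x, Continuous fun y => f (x, y)) : Continuous f :=
  continuous_prod_of_discrete_left.2 hf

lemma IsLCGroup.of_compactSpace {K : Type*} [Group K] [TopologicalSpace K]
    [IsTopologicalGroup K] [T2Space K] [CompactSpace K] : IsLCGroup K :=
  ⟨inferInstance, inferInstance, inferInstance⟩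

lemma IsLCGroup.of_discreteTopology {K : Type*} [Group K] [TopologicalSpace K]
    [DiscreteTopology K] : IsLCGroup K :=
  ⟨inferInstance, inferInstance, inferInstance⟩

lemma IsCompactlyGeneratedGroup.of_compactSpace {K : Type*} [Group K] [TopologicalSpace K]
    [CompactSpace K] : IsCompactlyGeneratedGroup K :=
  ⟨Set.univ, isCompact_univ, Subgroup.closure_univ⟩

/-! ### Coinduction and closed embeddings for compact kernels -/

/-- The subgroup `f (γ d) = γ • f d` of `D → K`, carrying the coinduced action of `D`. -/
def coinduced {K Γ D : Type*} [Group K] [Group Γ] [Group D] (φ : Γ →* MulAut K) (j : Γ →* D) :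
    Subgroup (D → K) where
  carrier := {f | ∀ γ d, f (j γ * d) = φ γ (f d)}
  mul_mem' hf hg γ d := by simp [hf γ d, hg γ d]
  one_mem' γ d := by simp
  inv_mem' hf γ d := by simp [hf γ d]

namespace coinduced

variable {K Γ D : Type*} [Group K] [Group Γ] [Group D] (φ : Γ →* MulAut K) (j : Γ →* D)

/-- `D` acts on the coinduced group by right translation. -/
def action : D →* MulAut (coinduced φ j) where
  toFun d :=
    { toFun := fun f => ⟨fun x => f.1 (x * d), fun γ x => by
        simpa only [mul_assoc] using f.2 γ (x * d)⟩
      invFun := fun f => ⟨fun x => f.1 (x * d⁻¹), fun γ x => by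
        simpa only [mul_assoc] using f.2 γ (x * d⁻¹)⟩
      left_inv := fun f => by ext; simp
      right_inv := fun f => by ext; simp
      map_mul' := fun f g => rfl }
  map_one' := by ext; simp
  map_mul' a b := by ext; simp [mul_assoc]

@[simp] lemma action_apply (d : D) (f : coinduced φ j) (x : D) :
    (action φ j d f).1 x = f.1 (x * d) := rfl

open scoped Classical in
/-- Embedding of `K` in the coinduced group as the functions supported on `Γ`. -/
noncomputable def single (hj : Function.Injective j) : K →* coinduced φ j where
  toFun k := ⟨fun x => if h : ∃ γ, j γ = x then φ h.choose k else 1, fun γ x => by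
    by_cases h : ∃ γ, j γ = x
    · have h' : ∃ γ', j γ' = j γ * x := ⟨γ * h.choose, by rw [map_mul, h.choose_spec]⟩
      have : h'.choose = γ * h.choose :=
        hj (by rw [h'.choose_spec, map_mul, h.choose_spec])
      simp only [h, h', dite_true, this, map_mul, MulAut.mul_apply]
    · have h' : ¬ ∃ γ', j γ' = j γ * x := fun ⟨γ', e⟩ => h ⟨γ⁻¹ * γ', by simp [e]⟩
      simp only [h, h', dite_false, map_one]⟩
  map_one' := by ext x; by_cases h : ∃ γ, j γ = x <;> simp [h]
  map_mul' a b := by ext x; by_cases h : ∃ γ, j γ = x <;> simp [h]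

variable {φ j}

lemma single_apply (hj : Function.Injective j) (k : K) (γ : Γ) :
    (single φ j hj k).1 (j γ) = φ γ k := by
  have h : ∃ γ', j γ' = j γ := ⟨γ, rfl⟩
  have : h.choose = γ := hj h.choose_spec
  simp only [single, MonoidHom.coe_mk, OneHom.coe_mk, h, dite_true, this]

lemma single_apply_of_notMem (hj : Function.Injective j) (k : K) {x : D}
    (hx : ¬ ∃ γ, j γ = x) : (single φ j hj k).1 x = 1 := by
  simp only [single, MonoidHom.coe_mk, OneHom.coe_mk, hx, dite_false]

/-- The set `j(Γ)` is stable under right translation by `j γ`, and on it both sides are evaluations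
of `φ (γ' * γ) k`. This equivariance lets `single` and `j` combine into a homomorphism of semidirect
products. -/
lemma single_smul (hj : Function.Injective j) (γ : Γ) (k : K) :
    single φ j hj (φ γ k) = action φ j (j γ) (single φ j hj k) := by
  ext x
  rw [action_apply]
  by_cases h : ∃ γ, j γ = x
  · obtain ⟨γ', rfl⟩ := h
    rw [← map_mul, single_apply, single_apply, map_mul, MulAut.mul_apply]
  · have h' : ¬ ∃ γ', j γ' = x * j γ := fun ⟨γ', e⟩ => h ⟨γ' * γ⁻¹, by simp [e]⟩
    rw [single_apply_of_notMem hj _ h, single_apply_of_notMem hj _ h']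

variable [TopologicalSpace K]

variable (φ j) in
lemma compactSpace [T2Space K] [CompactSpace K] (hφ : ∀ γ, Continuous (φ γ)) :
    CompactSpace (coinduced φ j) := by
  refine isCompact_iff_compactSpace.1 (IsClosed.isCompact ?_)
  have : (coinduced φ j : Set (D → K)) = ⋂ γ, ⋂ d, {f | f (j γ * d) = φ γ (f d)} := by
    ext f; simp [coinduced]
  rw [this]
  exact isClosed_iInter fun γ => isClosed_iInter fun d =>
    isClosed_eq (continuous_apply _) ((hφ γ).comp (continuous_apply d))

variable (φ j) in
lemma continuous_action (d : D) : Continuous (action φ j d) :=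
  continuous_induced_rng.2 <| continuous_pi fun x =>
    (continuous_apply (x * d)).comp continuous_subtype_val

/-- As `K` is compact, continuity and injectivity suffice; evaluation at `j 1` recovers the element
of `K`. -/
lemma isClosedEmbedding_single [T2Space K] [CompactSpace K] (hφ : ∀ γ, Continuous (φ γ))
    (hj : Function.Injective j) : IsClosedEmbedding (single φ j hj) := by
  refine Continuous.isClosedEmbedding (Continuous.subtype_mk (continuous_pi fun x => ?_) _) ?_
  · by_cases h : ∃ γ, j γ = x
    · simpa only [h, dite_true] using hφ _
    · simpa only [h, dite_false] using continuous_const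
  · intro a b hab
    have : (single φ j hj a).1 (j 1) = (single φ j hj b).1 (j 1) := by rw [hab]
    rwa [single_apply, single_apply, map_one φ] at this

end coinduced

/-- If `K` is compact and the discrete group `Γ` embeds in a finitely generated group, then
`K ⋊ Γ` is a closed subgroup of a compactly generated locally compact group. -/
lemma exists_isIsoToClosedSubgroup_of_compactSpace {K Γ D : Type} [Group K] [Group Γ] [Group D]
    [TopologicalSpace K] [IsTopologicalGroup K] [T2Space K] [CompactSpace K]
    [TopologicalSpace Γ] [DiscreteTopology Γ] [Group.FG D] {φ : Γ →* MulAut K}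
    (hφ : ∀ γ, Continuous (φ γ)) (j : Γ →* D) (hj : Function.Injective j) :
    ∃ (G : Type) (_ : Group G) (_ : TopologicalSpace G), IsLCGroup G ∧
      IsCompactlyGeneratedGroup G ∧ IsIsoToClosedSubgroup (SemidirectProduct K Γ φ) G := by
  let _ : TopologicalSpace D := ⊥
  have : DiscreteTopology D := ⟨rfl⟩
  have := coinduced.compactSpace φ j hφ
  refine ⟨SemidirectProduct (coinduced φ j) D (coinduced.action φ j), inferInstance,
    inferInstance, ?_, ?_, ?_⟩
  · exact SemidirectProduct.isLCGroup .of_compactSpace .of_discreteTopology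
      (continuous_prod_of_discrete fun d => coinduced.continuous_action φ j d)
  · refine SemidirectProduct.isCompactlyGeneratedGroup .of_compactSpace ?_
    obtain ⟨S, hS⟩ := Group.fg_iff.1 ‹Group.FG D›
    exact ⟨S, hS.2.isCompact, hS.1⟩
  · exact .of_isClosedEmbedding _ (SemidirectProduct.isClosedEmbedding_map
      (coinduced.isClosedEmbedding_single hφ hj)
      (.of_continuous_injective_isClosedMap continuous_of_discreteTopology hj
        fun _ _ => isClosed_discrete _)
      fun γ => by ext1 k; exact coinduced.single_smul hj γ k)

/-! ### The obstruction to being open -/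

/-- A homomorphism with open kernel from a compactly generated group to a commutative group has
finitely generated image. -/
lemma IsCompactlyGeneratedGroup.fg_range {G A : Type*} [Group G] [TopologicalSpace G]
    [IsTopologicalGroup G] [Group A] (hG : IsCompactlyGeneratedGroup G) (χ : G →* A)
    {U : Set G} (hU : U ∈ 𝓝 (1 : G)) (hχ : ∀ u ∈ U, χ u = 1) : χ.range.FG := by
  obtain ⟨S, hS, hSG⟩ := hG
  -- Finitely many translates `g * U` cover `S`, and `χ` is constant on each of them.
  obtain ⟨t, -, ht⟩ := hS.elim_nhds_subcover (fun g => (fun x => g⁻¹ * x) ⁻¹' U) fun g _ =>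
    (continuous_const_mul g⁻¹).continuousAt.preimage_mem_nhds (by simpa using hU)
  have hfin : (χ '' S).Finite := by
    refine (t.finite_toSet.image χ).subset ?_
    rintro _ ⟨s, hs, rfl⟩
    obtain ⟨g, hg, hgs⟩ := Set.mem_iUnion₂.1 (ht hs)
    refine ⟨g, hg, ?_⟩
    have := hχ _ hgs
    rw [map_mul, map_inv, inv_mul_eq_one] at this
    exact this
  rw [Subgroup.fg_iff]
  exact ⟨χ '' S, by rw [← MonoidHom.map_closure, hSG, MonoidHom.range_eq_map], hfin⟩

/-- `ℤ` is Noetherian, so submodules of a finite module are finite. -/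
lemma Subgroup.FG.fg_of_injective {A B : Type*} [CommGroup A] [CommGroup B] {P : Subgroup A}
    (hP : P.FG) (f : B →* A) (hf : Function.Injective f) (hfP : ∀ b, f b ∈ P) : Group.FG B := by
  have h1 : Group.FG P := (Group.fg_iff_subgroup_fg P).2 hP
  have h2 : AddGroup.FG (Additive P) := inferInstance
  have h3 : Module.Finite ℤ (Additive P) := Module.Finite.iff_addGroup_fg.2 h2
  let g : B →* P := f.codRestrict P hfP
  have hg : Function.Injective g := fun a b h => hf (congrArg Subtype.val h)
  have h4 : Module.Finite ℤ (Additive B) :=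
    Module.Finite.of_injective (MonoidHom.toAdditive g).toIntLinearMap hg
  have h5 : AddGroup.FG (Additive B) := Module.Finite.iff_addGroup_fg.1 h4
  exact GroupFG.iff_add_fg.2 h5

/-- Germs of one-parameter subgroups `L : F → G` normalised up to scaling by `G` give a
homomorphism `G →* Fˣ`. -/
lemma exists_scalingHom {F G : Type*} [Field F] [TopologicalSpace F] [ContinuousMul F]
    [(𝓝[≠] (0 : F)).NeBot] [Group G] (L : F → G) {V : Set F} (hV : V ∈ 𝓝 0) (hL : V.InjOn L)
    (hconj : ∀ g, ∃ c : F, ∀ᶠ x in 𝓝 0, g * L x * g⁻¹ = L (c * x)) :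
    ∃ χ : G →* Fˣ, ∀ g (c : F), (∀ᶠ x in 𝓝 0, g * L x * g⁻¹ = L (c * x)) → (χ g : F) = c := by
  have hcont (c : F) : Tendsto (fun x => c * x) (𝓝 0) (𝓝 0) := by
    simpa using (continuous_const_mul c).tendsto 0
  have huniq (c d : F) (h : ∀ᶠ x in 𝓝 0, L (c * x) = L (d * x)) : c = d := by
    -- Non-discreteness of `F` provides a nonzero `x` arbitrarily near `0`, which can then be
    -- cancelled.
    have h' : ∀ᶠ x in 𝓝[≠] (0 : F), c * x = d * x ∧ x ≠ 0 := by
      refine (Eventually.filter_mono nhdsWithin_le_nhds ?_).and self_mem_nhdsWithin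
      filter_upwards [h, hcont c hV, hcont d hV] with x hx hc hd using hL hc hd hx
    obtain ⟨x, hx, hx0⟩ := h'.exists
    exact mul_right_cancel₀ hx0 hx
  choose c hc using hconj
  have hone : c 1 = 1 := huniq _ _ (by filter_upwards [hc 1] with x hx; simpa using hx.symm)
  have hmul (g h : G) : c (g * h) = c g * c h := huniq _ _ <| by
    filter_upwards [hc (g * h), hc h, hcont (c h) (hc g)] with x h1 h2 h3
    rw [← h1, mul_assoc (c g), ← show g * L (c h * x) * g⁻¹ = L (c g * (c h * x)) from h3, ← h2]
    group
  refine ⟨MonoidHom.toHomUnits ⟨⟨c, hone⟩, hmul⟩, fun g d hd => huniq _ _ ?_⟩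
  filter_upwards [hc g, hd] with x h1 h2
  exact h1.symm.trans h2

/-- `K ⋊ Γ` is not open in a compactly generated group if `Γ`, not finitely generated, acts
faithfully by scalars on a one-parameter subgroup of `K` which is preserved up to scaling by all
local automorphisms of `K`. -/
lemma not_isIsoToOpenSubgroup {K Γ F : Type} [CommGroup K] [TopologicalSpace K] [CommGroup Γ]
    [TopologicalSpace Γ] [DiscreteTopology Γ] {φ : Γ →* MulAut K} [Field F]
    [TopologicalSpace F] [ContinuousMul F] [(𝓝[≠] (0 : F)).NeBot]
    (L : F → K) {V : Set F} (hV : V ∈ 𝓝 0) (hL : V.InjOn L) (χ : Γ →* Fˣ)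
    (hχ : Function.Injective χ) (hΓ : ¬ Group.FG Γ)
    (hφ : ∀ γ, ∀ᶠ x in 𝓝 0, φ γ (L x) = L (χ γ * x))
    (hconj : ∀ (G : Type u) [Group G] [TopologicalSpace G] [IsTopologicalGroup G] (κ : K →* G),
      IsOpenEmbedding κ → ∀ g : G, ∃ c : F, ∀ᶠ x in 𝓝 0, g * κ (L x) * g⁻¹ = κ (L (c * x)))
    (G : Type u) [Group G] [TopologicalSpace G] (hG : IsLCGroup G)
    (hGc : IsCompactlyGeneratedGroup G) :
    ¬ IsIsoToOpenSubgroup (SemidirectProduct K Γ φ) G := by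
  rintro ⟨S, hS, ⟨e⟩⟩
  have := hG.isTopologicalGroup
  let i : SemidirectProduct K Γ φ →* G := S.subtype.comp e.toMulEquiv.toMonoidHom
  have hi : IsOpenEmbedding i := hS.isOpenEmbedding_subtypeVal.comp e.toHomeomorph.isOpenEmbedding
  let κ : K →* G := i.comp SemidirectProduct.inl
  have hκ : IsOpenEmbedding κ := by
    refine hi.comp ?_
    have : IsOpenEmbedding fun k : K => (k, (1 : Γ)) :=
      ⟨isEmbedding_prodMkLeft 1, by
        have : Set.range (fun k : K => (k, (1 : Γ))) = Prod.snd ⁻¹' {1} := by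
          ext ⟨a, b⟩; simp [eq_comm]
        rw [this]
        exact (isOpen_discrete _).preimage continuous_snd⟩
    exact (SemidirectProduct.homeomorphProd φ).symm.isOpenEmbedding.comp this
  obtain ⟨X, hX⟩ := exists_scalingHom (κ ∘ L) hV (hκ.injective.comp_injOn hL) (hconj G κ hκ)
  -- `K` is commutative, so its elements fix the germ and have scalar `1`; its image is the required
  -- neighbourhood of the identity.
  have hfg := hGc.fg_range X (hκ.isOpen_range.mem_nhds ⟨1, map_one κ⟩) (by
    rintro _ ⟨k, rfl⟩
    refine Units.ext (hX _ 1 (.of_forall fun x => ?_))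
    simp [← map_mul, ← map_inv, mul_comm k])
  refine hΓ (hfg.fg_of_injective χ hχ fun γ => ⟨i (SemidirectProduct.inr γ), Units.ext ?_⟩)
  refine hX _ _ ((hφ γ).mono fun x hx => ?_)
  simp only [Function.comp_apply, κ, MonoidHom.comp_apply, ← hx, SemidirectProduct.inl_aut,
    map_mul, map_inv]

/-! ### The free abelian group, its finitely generated overgroup and its scalars -/

/-- The free abelian group on `ℤ`, written multiplicatively. -/
abbrev FreeAbZ : Type := Multiplicative (ℤ →₀ ℤ)

namespace FreeAbZ

/-- The basis of `FreeAbZ`. -/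
noncomputable def gen (j : ℤ) : FreeAbZ := Multiplicative.ofAdd (Finsupp.single j 1)

lemma closure_range_gen : Subgroup.closure (Set.range gen) = ⊤ := by
  refine eq_top_iff.2 fun x _ => ?_
  induction x using Multiplicative.rec with | ofAdd f => ?_
  induction f using Finsupp.induction_linear with
  | zero => exact one_mem _
  | add f g hf hg => exact mul_mem (hf trivial) (hg trivial)
  | single j k =>
    have : Multiplicative.ofAdd (Finsupp.single j k) = gen j ^ k := by
      rw [gen, ← ofAdd_zsmul]; simp
    rw [this]
    exact zpow_mem (Subgroup.subset_closure (Set.mem_range_self j)) k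

lemma hom_ext {A : Type*} [Group A] {f g : FreeAbZ →* A} (h : ∀ j, f (gen j) = g (gen j)) :
    f = g :=
  MonoidHom.eq_of_eqOn_dense closure_range_gen (by rintro _ ⟨j, rfl⟩; exact h j)

/-- The homomorphism with prescribed values on the basis. -/
noncomputable def lift {A : Type*} [CommGroup A] (α : ℤ → A) : FreeAbZ →* A :=
  AddMonoidHom.toMultiplicativeLeft
    (Finsupp.liftAddHom fun j => zmultiplesHom (Additive A) (Additive.ofMul (α j)))

@[simp] lemma lift_gen {A : Type*} [CommGroup A] (α : ℤ → A) (j : ℤ) : lift α (gen j) = α j := by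
  simp [lift, gen]

/-- The `v i` play the role of valuations: composed with `lift α`, each reads off the `i`-th
coordinate. -/
lemma lift_injective {A : Type*} [CommGroup A] (α : ℤ → A) (v : ℤ → A →* Multiplicative ℤ)
    (hv : ∀ i j, v i (α j) = Multiplicative.ofAdd (if j = i then 1 else 0)) :
    Function.Injective (lift α) := by
  have key (i : ℤ) : (v i).comp (lift α) =
      AddMonoidHom.toMultiplicative (Finsupp.applyAddHom i) := by
    refine hom_ext fun j => ?_
    rw [MonoidHom.comp_apply, lift_gen, hv]
    simp [gen, Finsupp.single_apply]
  intro x y hxy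
  refine Finsupp.ext (f := x.toAdd) (g := y.toAdd) fun i => ?_
  have h := DFunLike.congr_fun (key i) x
  rw [MonoidHom.comp_apply, hxy, ← MonoidHom.comp_apply, key] at h
  exact h.symm

lemma not_fg : ¬ Group.FG FreeAbZ := fun h => by
  have h' : Module.Finite ℤ (ℤ →₀ ℤ) :=
    Module.Finite.iff_addGroup_fg.2 (AddGroup.fg_iff_mul_fg.2 h)
  exact (Module.Finite.finite_basis (Finsupp.basisSingleOne (R := ℤ) (ι := ℤ))).not_infinite
    inferInstance

/-- The shift action of `ℤ`. -/
noncomputable def shift : Multiplicative ℤ →* MulAut FreeAbZ where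
  toFun n := AddEquiv.toMultiplicative (Finsupp.domCongr (Equiv.addRight n.toAdd))
  map_one' := MulEquiv.ext fun x => Finsupp.ext fun i =>
    congrArg (fun k => (Multiplicative.toAdd x : ℤ →₀ ℤ) k) (by simp : i + -0 = i)
  map_mul' a b := MulEquiv.ext fun x => Finsupp.ext fun i =>
    congrArg (fun k => (Multiplicative.toAdd x : ℤ →₀ ℤ) k)
      (by rw [neg_add, add_assoc] : i + -(a.toAdd + b.toAdd) = i + -a.toAdd + -b.toAdd)

lemma shift_gen (n : Multiplicative ℤ) (j : ℤ) : shift n (gen j) = gen (j + n.toAdd) := by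
  simp [shift, gen]

instance wreath_fg : Group.FG (SemidirectProduct FreeAbZ (Multiplicative ℤ) shift) := by
  refine Group.fg_iff.2 ⟨{SemidirectProduct.inl (gen 0),
    SemidirectProduct.inr (Multiplicative.ofAdd 1)}, ?_, by simp⟩
  set P := Subgroup.closure ({SemidirectProduct.inl (gen 0),
    SemidirectProduct.inr (Multiplicative.ofAdd 1)} :
      Set (SemidirectProduct FreeAbZ (Multiplicative ℤ) shift)) with hP
  have hr (n : Multiplicative ℤ) : SemidirectProduct.inr n ∈ P := by
    have : n = Multiplicative.ofAdd 1 ^ n.toAdd := by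
      rw [← ofAdd_zsmul]; simp
    rw [this, map_zpow]
    exact zpow_mem (Subgroup.subset_closure (by simp)) _
  have hl : (⊤ : Subgroup FreeAbZ) ≤ P.comap SemidirectProduct.inl := by
    rw [← closure_range_gen, Subgroup.closure_le]
    rintro _ ⟨j, rfl⟩
    -- Conjugating `gen 0` by powers of the shift produces every basis element.
    have : gen j = shift (Multiplicative.ofAdd j) (gen 0) := by rw [shift_gen]; simp
    rw [SetLike.mem_coe, Subgroup.mem_comap, this, SemidirectProduct.inl_aut]
    exact mul_mem (mul_mem (hr _) (Subgroup.subset_closure (by simp))) (hr _)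
  refine eq_top_iff.2 fun x _ => ?_
  rw [← SemidirectProduct.inl_left_mul_inr_right x]
  exact mul_mem (hl trivial) (hr _)

/-- A sequence of distinct odd primes indexed by `ℤ`. -/
noncomputable def oddPrime (j : ℤ) : ℕ := Nat.nth Nat.Prime (Equiv.intEquivNat j + 1)

lemma oddPrime_prime (j : ℤ) : (oddPrime j).Prime := Nat.prime_nth_prime _

lemma oddPrime_injective : Function.Injective oddPrime :=
  (Nat.nth_injective Nat.infinite_setOfPred_prime).comp
    ((add_left_injective 1).comp Equiv.intEquivNat.injective)

lemma oddPrime_ne_two (j : ℤ) : oddPrime j ≠ 2 := by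
  -- The prime `2` has index `0`, which the `+ 1` in `oddPrime` skips.
  rw [← Nat.nth_prime_zero_eq_two]
  exact fun h => absurd (Nat.nth_injective Nat.infinite_setOfPred_prime h) (by simp)

/-- The embedding of `FreeAbZ` in `ℚˣ` with image generated by odd primes. -/
noncomputable def toRat : FreeAbZ →* ℚˣ :=
  lift fun j => Units.mk0 (oddPrime j : ℚ) (by exact_mod_cast (oddPrime_prime j).ne_zero)

/-- The `p`-adic valuation as a homomorphism. -/
noncomputable def ratValHom (p : ℕ) [Fact p.Prime] : ℚˣ →* Multiplicative ℤ where
  toFun q := Multiplicative.ofAdd (padicValRat p q)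
  map_one' := by simp
  map_mul' a b := by simp [padicValRat.mul a.ne_zero b.ne_zero]

lemma toRat_injective : Function.Injective toRat := by
  refine lift_injective _ (fun i => haveI : Fact (oddPrime i).Prime := ⟨oddPrime_prime i⟩
    ratValHom (oddPrime i)) fun i j => ?_
  have hi : Fact (oddPrime i).Prime := ⟨oddPrime_prime i⟩
  have hj : Fact (oddPrime j).Prime := ⟨oddPrime_prime j⟩
  split_ifs with h
  · subst h; simp [ratValHom]
  · have : oddPrime i ≠ oddPrime j := fun e => h (oddPrime_injective e).symm
    simp [ratValHom, padicValNat_primes this]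

/-- The embedding of `FreeAbZ` in the units of a field of characteristic zero. -/
noncomputable def toUnits (F : Type*) [Field F] [CharZero F] : FreeAbZ →* Fˣ :=
  (Units.map (algebraMap ℚ F : ℚ →* F)).comp toRat

lemma toUnits_injective (F : Type*) [Field F] [CharZero F] :
    Function.Injective (toUnits F) :=
  (Units.map_injective (algebraMap ℚ F).injective).comp toRat_injective

@[simp] lemma coe_toUnits (F : Type*) [Field F] [CharZero F] (x : FreeAbZ) :
    (toUnits F x : F) = ((toRat x : ℚ) : F) := by simp [toUnits]

/-- Positivity makes these scalars exponentials of reals, as the ambient group in the Lie case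
requires. -/
lemma toRat_pos (x : FreeAbZ) : (0 : ℚ) < toRat x := by
  have : x ∈ Subgroup.closure (Set.range gen) := closure_range_gen ▸ trivial
  induction this using Subgroup.closure_induction with
  | mem x hx =>
    obtain ⟨j, rfl⟩ := hx
    simp [toRat, (oddPrime_prime j).pos]
  | one => simp
  | mul x y _ _ hx hy => simpa using mul_pos hx hy
  | inv x _ hx => simpa using hx

end FreeAbZ

/-! ### The solenoid: a compact connected kernel -/

instance : SimplyConnectedSpace ℝ := SimplyConnectedSpace.ofContractible ℝ

/-- Continuous characters of `ℝ` are exponentials. -/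
lemma exists_eq_exp_of_continuous {ψ : ℝ → Circle} (hψ : Continuous ψ)
    (hadd : ∀ x y, ψ (x + y) = ψ x * ψ y) : ∃ a : ℝ, ∀ x, ψ x = Circle.exp (a * x) := by
  have h0 : ψ 0 = 1 := by simpa using hadd 0 0
  obtain ⟨f, ⟨hf0, hf⟩, -⟩ := Circle.isCoveringMap_exp.existsUnique_continuousMap_lifts
    ⟨ψ, hψ⟩ 0 0 (by simp [h0])
  have hf' (x : ℝ) : Circle.exp (f x) = ψ x := congrFun hf x
  -- Both sides lift the same map on the connected space `ℝ × ℝ` and agree at `0`.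
  have hfadd : (fun p : ℝ × ℝ => f (p.1 + p.2)) = fun p => f p.1 + f p.2 :=
    Circle.isCoveringMap_exp.eq_of_comp_eq (by fun_prop) (by fun_prop)
      (by ext1 p; simp [hf', hadd, Circle.exp_add]) 0 (by simp [hf0])
  let F : ℝ →+ ℝ := ⟨⟨f, hf0⟩, fun x y => congrFun hfadd (x, y)⟩
  refine ⟨f 1, fun x => ?_⟩
  have : f x = x * f 1 := by
    have := map_real_smul F f.continuous x 1
    rwa [smul_eq_mul, smul_eq_mul, mul_one] at this
  rw [← hf', this, mul_comm]

/-- The dual group of the discrete group `ℚ`. -/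
def Solenoid : Subgroup (ℚ → Circle) where
  carrier := {f | ∀ x y, f (x + y) = f x * f y}
  mul_mem' hf hg x y := by simp [hf x y, hg x y, mul_mul_mul_comm]
  one_mem' x y := by simp
  inv_mem' hf x y := by simp [hf x y, mul_comm]

namespace Solenoid

instance : SecondCountableTopology Solenoid :=
  have : SecondCountableTopology Circle :=
    inferInstanceAs (SecondCountableTopology (Submonoid.unitSphere ℂ))
  have : SecondCountableTopology (ℚ → Circle) := inferInstance
  IsEmbedding.subtypeVal.secondCountableTopology

instance : CompactSpace Solenoid := by
  refine isCompact_iff_compactSpace.1 (IsClosed.isCompact ?_)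
  have : (Solenoid : Set (ℚ → Circle)) = ⋂ x, ⋂ y, {f | f (x + y) = f x * f y} := by
    ext f; simp [Solenoid]
  rw [this]
  exact isClosed_iInter fun x => isClosed_iInter fun y =>
    isClosed_eq (continuous_apply _) ((continuous_apply x).mul (continuous_apply y))

/-- The one-parameter subgroup of the solenoid. -/
noncomputable def line (x : ℝ) : Solenoid :=
  ⟨fun q => Circle.exp (q * x), fun a b => by rw [← Circle.exp_add]; push_cast; ring_nf⟩

@[simp] lemma line_apply (x : ℝ) (q : ℚ) : (line x).1 q = Circle.exp (q * x) := rfl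

lemma continuous_line : Continuous line :=
  Continuous.subtype_mk (continuous_pi fun q => by fun_prop) _

lemma line_injective : Function.Injective line := by
  intro x y hxy
  by_contra hne
  -- With `q` this small, `q * (x - y)` lies in `[-1, 1]`, where the circle exponential is
  -- injective.
  obtain ⟨q, hq0, hq⟩ := exists_rat_btwn (inv_pos.2 (abs_pos.2 (sub_ne_zero.2 hne)))
  have h : Circle.exp (q * x) = Circle.exp (q * y) := by
    simpa using congrArg (fun f : Solenoid => f.1 q) hxy
  have h1 : |q * (x - y)| < 1 := by
    rw [abs_mul, abs_of_pos hq0]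
    calc (q : ℝ) * |x - y| < |x - y|⁻¹ * |x - y| := by
          gcongr
      _ = 1 := inv_mul_cancel₀ (abs_pos.2 (sub_ne_zero.2 hne)).ne'
  have h2 : Circle.exp (q * (x - y)) = Circle.exp 0 := by
    rw [mul_sub, Circle.exp_sub, h]; simp
  have h3 := Circle.exp_injOn_Icc (a := -1) (b := 1) (by linarith [Real.pi_gt_three])
    (Set.mem_Icc.2 (abs_le.1 h1.le)) (Set.mem_Icc.2 ⟨by norm_num, by norm_num⟩) h2
  rcases mul_eq_zero.1 h3 with h | h
  · exact hq0.ne' h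
  · exact hne (sub_eq_zero.1 h)

lemma apply_intCast_mul (f : Solenoid) (n : ℤ) (q : ℚ) : f.1 (n * q) = f.1 q ^ n := by
  let g : Multiplicative ℚ →* Circle := MonoidHom.mk' (fun x => f.1 x.toAdd) fun a b => f.2 _ _
  have := map_zpow g (Multiplicative.ofAdd q) n
  rw [← ofAdd_zsmul, zsmul_eq_mul] at this
  exact this

/-- A basic neighbourhood constrains only finitely many rationals. They have a common denominator
`d`, so a character is determined on them by its value at `1 / d`, which some point of the line
matches. -/
lemma denseRange_line : DenseRange line := by
  intro f
  rw [mem_closure_iff_nhds]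
  intro t ht
  obtain ⟨u, hu, hut⟩ := mem_nhds_subtype _ _ _ |>.1 ht
  rw [nhds_pi, Filter.mem_pi] at hu
  obtain ⟨I, hI, s, hs, hsu⟩ := hu
  let d : ℕ := ∏ q ∈ hI.toFinset, q.den
  have hd : (d : ℚ) ≠ 0 := by
    exact_mod_cast Finset.prod_ne_zero_iff.2 fun q _ => Rat.den_ne_zero q
  obtain ⟨y, hy⟩ := Circle.exp_surjective (f.1 (1 / d))
  refine ⟨line (d * y), hut (hsu fun q hq => ?_), d * y, rfl⟩
  obtain ⟨k, hk⟩ : q.den ∣ d := Finset.dvd_prod_of_mem _ (hI.mem_toFinset.2 hq)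
  have hq' : q = ((q.num * k : ℤ) : ℚ) * (1 / d) := by
    rw [mul_one_div, eq_div_iff hd, hk]
    push_cast
    rw [← mul_assoc, Rat.mul_den_eq_num]
  have : (line (d * y)).1 q = f.1 q := by
    conv_rhs => rw [hq', apply_intCast_mul, ← hy, ← Circle.exp_zsmul]
    rw [line_apply]
    congr 1
    have hdR : (d : ℝ) ≠ 0 := by exact_mod_cast hd
    have := congrArg (Rat.cast : ℚ → ℝ) hq'
    push_cast at this
    rw [this]
    push_cast [zsmul_eq_mul]
    field_simp
  rw [this]
  exact mem_of_mem_nhds (hs q)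

instance : ConnectedSpace Solenoid := by
  have h := (isConnected_range continuous_line).closure
  rw [denseRange_line.closure_range] at h
  exact connectedSpace_iff_univ.2 h

/-- Scaling by rational numbers. -/
def scaling : ℚˣ →* MulAut Solenoid where
  toFun r :=
    { toFun := fun f => ⟨fun q => f.1 (r * q), fun x y => by
        simpa only [mul_add] using f.2 _ _⟩
      invFun := fun f => ⟨fun q => f.1 (r⁻¹ * q), fun x y => by
        simpa only [mul_add] using f.2 _ _⟩
      left_inv := fun f => by ext; simp
      right_inv := fun f => by ext; simp
      map_mul' := fun f g => rfl }
  map_one' := by ext; simp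
  map_mul' a b := by
    refine MulEquiv.ext fun f => Subtype.ext (funext fun q => ?_)
    exact congrArg f.1 (by simp only [Units.val_mul]; ring)

lemma continuous_scaling (r : ℚˣ) : Continuous (scaling r) :=
  continuous_induced_rng.2 <| continuous_pi fun q =>
    (continuous_apply ((r : ℚ) * q)).comp continuous_subtype_val

lemma scaling_line (r : ℚˣ) (x : ℝ) : scaling r (line x) = line ((r : ℚ) * x) := by
  refine Subtype.ext (funext fun q => ?_)
  change Circle.exp _ = Circle.exp _
  congr 1
  push_cast
  ring

/-- Each coordinate is a character of `ℝ` with some slope `a q`. Uniqueness of slopes makes `a`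
additive, hence `ℚ`-linear, so `a 1` is the scalar. -/
lemma exists_eq_line {M : ℝ → Solenoid} (hM : Continuous M)
    (hadd : ∀ x y, M (x + y) = M x * M y) : ∃ c : ℝ, ∀ x, M x = line (c * x) := by
  have h (q : ℚ) : ∃ a : ℝ, ∀ x, (M x).1 q = Circle.exp (a * x) :=
    exists_eq_exp_of_continuous ((continuous_apply q).comp (continuous_subtype_val.comp hM))
      fun x y => by rw [hadd]; rfl
  choose a ha using h
  have hadd' (q r : ℚ) : a (q + r) = a q + a r := by
    have key (x : ℝ) : Circle.exp (a (q + r) * x) = Circle.exp ((a q + a r) * x) := by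
      rw [← ha, (M x).2, ha, ha, ← Circle.exp_add, add_mul]
    by_contra hne
    obtain ⟨b, hb⟩ : ∃ b, b = a (q + r) - (a q + a r) := ⟨_, rfl⟩
    have hb0 : b ≠ 0 := hb ▸ sub_ne_zero.2 hne
    -- Evaluating at `x = b⁻¹` gives `exp 1 = exp 0`, impossible since `1 < 2π`.
    have h1 : Circle.exp (b * b⁻¹) = Circle.exp 0 := by
      rw [hb, sub_mul, Circle.exp_sub, ← hb, key]; simp
    rw [mul_inv_cancel₀ hb0] at h1
    exact one_ne_zero (Circle.exp_injOn_Icc (a := 0) (b := 1) (by linarith [Real.pi_gt_three])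
      (by simp) (by simp) h1)
  let A : ℚ →+ ℝ := AddMonoidHom.mk' a hadd'
  refine ⟨a 1, fun x => Subtype.ext (funext fun q => ?_)⟩
  rw [ha, line_apply]
  have : a q = q * a 1 := by
    have := map_rat_smul A q 1
    rw [smul_eq_mul, mul_one, Rat.smul_def] at this
    exact this
  rw [this, mul_assoc]

end Solenoid

/-- One-parameter subgroups of an open subgroup are preserved by conjugation. -/
lemma exists_conj_line {K : Type} [CommGroup K] [TopologicalSpace K] (L : ℝ → K)
    (hL : Continuous L) (hadd : ∀ x y, L (x + y) = L x * L y)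
    (hex : ∀ M : ℝ → K, Continuous M → (∀ x y, M (x + y) = M x * M y) →
      ∃ c : ℝ, ∀ x, M x = L (c * x))
    (G : Type u) [Group G] [TopologicalSpace G] [IsTopologicalGroup G] (κ : K →* G)
    (hκ : IsOpenEmbedding κ) (g : G) :
    ∃ c : ℝ, ∀ᶠ x in 𝓝 0, g * κ (L x) * g⁻¹ = κ (L (c * x)) := by
  let Q : ℝ → G := fun x => g * κ (L x) * g⁻¹
  have hQ : Continuous Q := ((hκ.continuous.comp hL).const_mul g).mul_const g⁻¹
  have h0 : L 0 = 1 := by simpa using hadd 0 0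
  -- An open subgroup is also closed, so by connectedness of `ℝ` the whole conjugated line stays in
  -- `K`.
  have hclopen : IsClopen (Q ⁻¹' Set.range κ) := by
    have : IsClopen (κ.range : Set G) := by
      have ho : IsOpen (κ.range : Set G) := by simpa using hκ.isOpen_range
      exact ⟨κ.range.isClosed_of_isOpen ho, ho⟩
    rw [MonoidHom.coe_range] at this
    exact this.preimage hQ
  have hmem (x : ℝ) : Q x ∈ Set.range κ := by
    have := hclopen.eq_univ ⟨0, 1, by simp [Q, h0]⟩
    exact (Set.ext_iff.1 this x).2 trivial
  choose M hM using hmem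
  obtain ⟨c, hc⟩ := hex M (hκ.isInducing.continuous_iff.2 (by
      convert hQ using 1; exact funext hM)) fun x y => hκ.injective (by
    rw [map_mul, hM, hM, hM]; simp only [Q, hadd, map_mul]; group)
  exact ⟨c, .of_forall fun x => by rw [← hc, hM]⟩

instance : TopologicalSpace FreeAbZ := ⊥
instance : DiscreteTopology FreeAbZ := ⟨rfl⟩
instance : Countable FreeAbZ := inferInstanceAs (Countable (ℤ →₀ ℤ))

/-- The semidirect product of a compact metrizable group with `FreeAbZ` embeds as a closed
subgroup of a compactly generated group. -/
lemma EmbedsClosedNotOpen.of_compactSpace {K : Type} [CommGroup K] [TopologicalSpace K]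
    [IsTopologicalGroup K] [T2Space K] [CompactSpace K] [SecondCountableTopology K]
    {φ : FreeAbZ →* MulAut K} (hφ : ∀ γ, Continuous (φ γ))
    (h : ∀ (G : Type u) [Group G] [TopologicalSpace G],
      IsLCGroup G → IsCompactlyGeneratedGroup G →
        ¬ IsIsoToOpenSubgroup (SemidirectProduct K FreeAbZ φ) G) :
    EmbedsClosedNotOpen.{u} (SemidirectProduct K FreeAbZ φ) := by
  have h1 : IsLCGroup (SemidirectProduct K FreeAbZ φ) :=
    SemidirectProduct.isLCGroup .of_compactSpace .of_discreteTopology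
      (continuous_prod_of_discrete hφ)
  have h2 : SecondCountableTopology (SemidirectProduct K FreeAbZ φ) :=
    (SemidirectProduct.homeomorphProd φ).isEmbedding.secondCountableTopology
  have := h1.locallyCompactSpace
  -- The finitely generated overgroup is `ℤ ≀ ℤ`, with `FreeAbZ` as its base.
  exact ⟨h1, h2, inferInstance, exists_isIsoToClosedSubgroup_of_compactSpace hφ
    (SemidirectProduct.inl (φ := FreeAbZ.shift)) SemidirectProduct.inl_injective, h⟩

lemma Solenoid.embedsClosedNotOpen : EmbedsClosedNotOpen.{u}
    (SemidirectProduct Solenoid FreeAbZ (Solenoid.scaling.comp FreeAbZ.toRat)) := by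
  refine .of_compactSpace (fun γ => Solenoid.continuous_scaling _) fun G _ _ hG hGc => ?_
  refine not_isIsoToOpenSubgroup Solenoid.line univ_mem Solenoid.line_injective.injOn
    (FreeAbZ.toUnits ℝ) (FreeAbZ.toUnits_injective ℝ) FreeAbZ.not_fg
    (fun γ => .of_forall fun x => ?_)
    (exists_conj_line _ Solenoid.continuous_line (fun x y => ?_)
      fun M hM hadd => Solenoid.exists_eq_line hM hadd) G hG hGc
  · simpa using Solenoid.scaling_line _ _
  · refine Subtype.ext (funext fun q => ?_)
    change Circle.exp _ = Circle.exp _ * Circle.exp _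
    rw [mul_add, Circle.exp_add]

/-! ### The 2-adic integers: a profinite kernel -/

namespace PadicInt

variable (p : ℕ) [Fact p.Prime]

/-- The partially defined inverse `ℚ_p → ℤ_p` of the inclusion, extended by the identity element. -/
noncomputable def germ (x : ℚ_[p]) : Multiplicative ℤ_[p] :=
  if h : ‖x‖ ≤ 1 then Multiplicative.ofAdd ⟨x, h⟩ else 1

variable {p}

lemma germ_coe (x : ℤ_[p]) : germ p x = Multiplicative.ofAdd x := by
  rw [germ, dif_pos (by exact x.2)]
  rfl

lemma range_coe_mem_nhds : (Set.range fun x : ℤ_[p] => (x : ℚ_[p])) ∈ 𝓝 0 :=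
  isOpenEmbedding_coe.isOpen_range.mem_nhds ⟨(0 : ℤ_[p]), coe_zero⟩

lemma injOn_germ : (Set.range (fun x : ℤ_[p] => (x : ℚ_[p]))).InjOn (germ p) := by
  rintro _ ⟨x, rfl⟩ _ ⟨y, rfl⟩ h
  beta_reduce at h
  rw [germ_coe, germ_coe] at h
  rw [Multiplicative.ofAdd.injective h]

lemma eq_mul_of_continuous {σ : ℤ_[p] →+ ℤ_[p]} (hσ : Continuous σ) (x : ℤ_[p]) :
    σ x = σ 1 * x := by
  refine congrFun (denseRange_intCast.equalizer hσ (continuous_const_mul (σ 1)) ?_) x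
  ext1 n
  have := map_zsmul σ n 1
  rw [zsmul_one, zsmul_eq_mul, mul_comm] at this
  exact this

/-- Connectedness is unavailable here, but by continuity conjugation carries some `p ^ n ℤ_p` into
`K`. Precomposing with multiplication by `p ^ n` gives a continuous endomorphism of `ℤ_p`, which is
a multiplication. -/
lemma exists_conj_germ (G : Type u) [Group G] [TopologicalSpace G] [IsTopologicalGroup G]
    (κ : Multiplicative ℤ_[p] →* G) (hκ : IsOpenEmbedding κ) (g : G) :
    ∃ c : ℚ_[p], ∀ᶠ x in 𝓝 0, g * κ (germ p x) * g⁻¹ = κ (germ p (c * x)) := by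
  let Q : ℤ_[p] → G := fun x => g * κ (Multiplicative.ofAdd x) * g⁻¹
  have hQ : Continuous Q :=
    ((hκ.continuous.comp continuous_ofAdd).const_mul g).mul_const g⁻¹
  have hQ0 : Q 0 = 1 := by simp [Q]
  have hmem : Q ⁻¹' Set.range κ ∈ 𝓝 0 := hQ.continuousAt.preimage_mem_nhds
    (hκ.isOpen_range.mem_nhds ⟨1, by rw [hQ0, map_one]⟩)
  have hlim : Tendsto (fun n : ℕ => (p : ℤ_[p]) ^ n) atTop (𝓝 0) :=
    tendsto_pow_atTop_nhds_zero_of_norm_lt_one (norm_lt_one_iff_dvd _ |>.2 dvd_rfl)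
  obtain ⟨ε, hε, hball⟩ := Metric.mem_nhds_iff.1 hmem
  obtain ⟨n, hn⟩ := (hlim.eventually (Metric.ball_mem_nhds 0 hε)).exists
  have hp0 : (p : ℚ_[p]) ^ n ≠ 0 :=
    pow_ne_zero _ (Nat.cast_ne_zero.2 (Fact.out : p.Prime).ne_zero)
  have hmem' (y : ℤ_[p]) : Q ((p : ℤ_[p]) ^ n * y) ∈ Set.range κ := by
    refine hball ?_
    rw [dist_zero_right] at hn
    rw [Metric.mem_ball, dist_zero_right]
    rw [norm_mul]
    exact (mul_le_of_le_one_right (norm_nonneg _) (norm_le_one y)).trans_lt hn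
  choose M hM using hmem'
  let σ : ℤ_[p] →+ ℤ_[p] := AddMonoidHom.mk' (fun y => (M y).toAdd) fun x y => by
    rw [← toAdd_mul]
    congr 1
    refine hκ.injective ?_
    rw [map_mul, hM, hM, hM]
    simp only [Q, mul_add, ofAdd_add, map_mul]
    group
  have hσ : Continuous σ := continuous_toAdd.comp <| hκ.isInducing.continuous_iff.2 <| by
    convert hQ.comp (continuous_const_mul ((p : ℤ_[p]) ^ n)) using 1
    exact funext hM
  -- For `x = p ^ n * y` the conjugate is `σ y = σ 1 * y`. Dividing by `p ^ n` may leave `ℤ_p`,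
  -- which is why the scalars live in `ℚ_p`.
  refine ⟨σ 1 / (p : ℚ_[p]) ^ n, ?_⟩
  have hnhds : ∀ᶠ x in 𝓝 (0 : ℚ_[p]), x / (p : ℚ_[p]) ^ n ∈
      Set.range fun x : ℤ_[p] => (x : ℚ_[p]) :=
    (continuous_id.div_const _).continuousAt.preimage_mem_nhds (by
      simpa using range_coe_mem_nhds)
  filter_upwards [hnhds] with x ⟨y, hy⟩
  have hx : x = ((p : ℤ_[p]) ^ n * y : ℤ_[p]) := by
    rw [coe_mul, coe_pow, coe_natCast, show (y : ℚ_[p]) = _ from hy, mul_div_cancel₀ _ hp0]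
  have hcx : (σ 1 : ℚ_[p]) / (p : ℚ_[p]) ^ n * x = (σ y : ℤ_[p]) := by
    rw [eq_mul_of_continuous hσ y]
    rw [coe_mul, show (y : ℚ_[p]) = _ from hy]
    ring
  rw [hcx, hx, germ_coe, germ_coe]
  exact (hM y).symm

/-- The action of `ℤ_pˣ` on `ℤ_p` by multiplication. -/
noncomputable def unitsAction : ℤ_[p]ˣ →* MulAut (Multiplicative ℤ_[p]) where
  toFun u := AddEquiv.toMultiplicative (AddAut.mulLeft u)
  map_one' := MulEquiv.ext fun x => one_mul x.toAdd
  map_mul' a b := MulEquiv.ext fun x => mul_assoc (a : ℤ_[p]) b x.toAdd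

lemma continuous_unitsAction (u : ℤ_[p]ˣ) : Continuous (unitsAction u) :=
  continuous_ofAdd.comp ((continuous_const_mul (u : ℤ_[p])).comp continuous_toAdd)

/-- This is where oddness of the primes matters: they must act on `ℤ_2` by automorphisms. -/
lemma isUnit_oddPrime (j : ℤ) : IsUnit (FreeAbZ.oddPrime j : ℤ_[2]) := by
  rw [isUnit_iff, norm_natCast_eq_one_iff]
  exact (Nat.coprime_primes Nat.prime_two (FreeAbZ.oddPrime_prime j)).2
    (FreeAbZ.oddPrime_ne_two j).symm

/-- The embedding of `FreeAbZ` in `ℤ_2ˣ`. -/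
noncomputable def ofFreeAbZ : FreeAbZ →* ℤ_[2]ˣ :=
  FreeAbZ.lift fun j => (isUnit_oddPrime j).unit

lemma coe_ofFreeAbZ (x : FreeAbZ) : ((ofFreeAbZ x : ℤ_[2]) : ℚ_[2]) = FreeAbZ.toUnits ℚ_[2] x := by
  have : (Units.map (Coe.ringHom (p := 2)).toMonoidHom).comp ofFreeAbZ = FreeAbZ.toUnits ℚ_[2] := by
    refine FreeAbZ.hom_ext fun j => Units.ext ?_
    simp [ofFreeAbZ, FreeAbZ.toRat]
  rw [← this]
  rfl

lemma embedsClosedNotOpen : EmbedsClosedNotOpen.{u}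
    (SemidirectProduct (Multiplicative ℤ_[2]) FreeAbZ (unitsAction.comp ofFreeAbZ)) := by
  refine .of_compactSpace (fun γ => continuous_unitsAction _) fun G _ _ hG hGc => ?_
  refine not_isIsoToOpenSubgroup (germ 2) range_coe_mem_nhds injOn_germ
    (FreeAbZ.toUnits ℚ_[2]) (FreeAbZ.toUnits_injective _) FreeAbZ.not_fg
    (fun γ => ?_) exists_conj_germ G hG hGc
  filter_upwards [range_coe_mem_nhds] with _ hx
  obtain ⟨x, rfl⟩ := hx
  beta_reduce
  rw [← coe_ofFreeAbZ, ← coe_mul, germ_coe, germ_coe]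
  rfl

end PadicInt

/-! ### The real line: closed embedding and obstruction -/

lemma IsLCGroup.prod {A B : Type*} [Group A] [Group B] [TopologicalSpace A] [TopologicalSpace B]
    (hA : IsLCGroup A) (hB : IsLCGroup B) : IsLCGroup (A × B) := by
  have := hA.isTopologicalGroup
  have := hB.isTopologicalGroup
  have := hA.t2Space
  have := hB.t2Space
  have := hA.locallyCompactSpace
  have := hB.locallyCompactSpace
  exact ⟨inferInstance, inferInstance, inferInstance⟩

lemma IsCompactlyGeneratedGroup.prod {A B : Type*} [Group A] [Group B] [TopologicalSpace A]
    [TopologicalSpace B] (hA : IsCompactlyGeneratedGroup A) (hB : IsCompactlyGeneratedGroup B) :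
    IsCompactlyGeneratedGroup (A × B) := by
  obtain ⟨S, hS, hSA⟩ := hA
  obtain ⟨T, hT, hTB⟩ := hB
  refine ⟨MonoidHom.inl A B '' S ∪ MonoidHom.inr A B '' T,
    (hS.image (Continuous.prodMk_left 1)).union (hT.image (Continuous.prodMk_right 1)),
    eq_top_iff.2 fun x _ => ?_⟩
  rw [Subgroup.closure_union, ← MonoidHom.map_closure, ← MonoidHom.map_closure, hSA, hTB,
    show x = MonoidHom.inl A B x.1 * MonoidHom.inr A B x.2 by simp]
  exact Subgroup.mul_mem_sup ⟨_, trivial, rfl⟩ ⟨_, trivial, rfl⟩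

lemma isLCGroup_multiplicative_real : IsLCGroup (Multiplicative ℝ) :=
  ⟨inferInstance, inferInstance, inferInstance⟩

lemma isCompactlyGeneratedGroup_multiplicative_real :
    IsCompactlyGeneratedGroup (Multiplicative ℝ) := by
  refine ⟨Multiplicative.ofAdd '' Set.Icc (-1) 1, isCompact_Icc.image continuous_ofAdd,
    eq_top_iff.2 fun x _ => ?_⟩
  obtain ⟨n, hn⟩ := exists_nat_gt |x.toAdd|
  have hn0 : (0 : ℝ) < n := (abs_nonneg _).trans_lt hn
  have hpow : Multiplicative.ofAdd (x.toAdd / n) ^ n = x := by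
    rw [← ofAdd_nsmul, nsmul_eq_mul, mul_div_cancel₀ _ hn0.ne', ofAdd_toAdd]
  have hle : |x.toAdd / n| ≤ 1 := by
    rw [abs_div, abs_of_pos hn0]
    exact div_le_one_of_le₀ hn.le hn0.le
  have hmem : Multiplicative.ofAdd (x.toAdd / n) ∈
      Subgroup.closure (Multiplicative.ofAdd '' Set.Icc (-1 : ℝ) 1) :=
    Subgroup.subset_closure ⟨_, abs_le.1 hle, rfl⟩
  exact hpow ▸ pow_mem hmem n

lemma continuous_realScaling {Λ : Type} [Group Λ] [TopologicalSpace Λ] {χ : Λ →* ℝˣ}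
    (hχ : Continuous χ) :
    Continuous fun p : Λ × Multiplicative ℝ => realScaling χ p.1 p.2 :=
  continuous_ofAdd.comp ((Units.continuous_val.comp (hχ.comp continuous_fst)).mul
    (continuous_toAdd.comp continuous_snd))

/-- The exponential as a homomorphism to `ℝˣ`. -/
noncomputable def expUnits : Multiplicative ℝ →* ℝˣ := Real.expMonoidHom.toHomUnits

@[simp] lemma coe_expUnits (x : Multiplicative ℝ) : (expUnits x : ℝ) = Real.exp x.toAdd := rfl

lemma continuous_expUnits : Continuous expUnits :=
  Units.continuous_iff.2 ⟨Real.continuous_exp.comp continuous_toAdd, by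
    have (x : Multiplicative ℝ) : ((expUnits x)⁻¹ : ℝˣ) = Real.exp (-x.toAdd) := by
      rw [Units.val_inv_eq_inv_val, coe_expUnits, Real.exp_neg]
    simp only [this]
    exact Real.continuous_exp.comp continuous_toAdd.neg⟩

namespace FreeAbZ

/-- The logarithm of the embedding of `FreeAbZ` in the positive reals. -/
noncomputable def log : FreeAbZ →* Multiplicative ℝ :=
  MonoidHom.mk' (fun x => Multiplicative.ofAdd (Real.log (toUnits ℝ x : ℝ))) fun x y => by
    rw [map_mul, Units.val_mul, Real.log_mul (Units.ne_zero _) (Units.ne_zero _), ofAdd_add]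

lemma expUnits_log (x : FreeAbZ) : expUnits (log x) = toUnits ℝ x := by
  refine Units.ext ?_
  refine Real.exp_log ?_
  rw [coe_toUnits]
  exact_mod_cast toRat_pos x

/-- The lamplighter-type group `ℤ ≀ ℤ`. -/
abbrev Wreath : Type := SemidirectProduct FreeAbZ (Multiplicative ℤ) shift

instance : DiscreteTopology Wreath :=
  (SemidirectProduct.homeomorphProd shift).isEmbedding.discreteTopology

/-- The diagonal embedding of `FreeAbZ`. -/
noncomputable def diag : FreeAbZ →* Multiplicative ℝ × Wreath :=
  log.prod SemidirectProduct.inl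

/-- The image of `log` alone is dense in `ℝ`; the discrete second coordinate is what makes the
diagonal map proper. -/
lemma isClosedEmbedding_diag : IsClosedEmbedding diag := by
  have hinl : IsClosedEmbedding (SemidirectProduct.inl : FreeAbZ →* Wreath) :=
    .of_continuous_injective_isClosedMap continuous_of_discreteTopology
      SemidirectProduct.inl_injective fun _ _ => isClosed_discrete _
  have hproper : IsProperMap diag := isProperMap_of_comp_of_t2 continuous_of_discreteTopology
    continuous_snd (show IsProperMap (Prod.snd ∘ diag) from hinl.isProperMap)
  exact .of_continuous_injective_isClosedMap hproper.continuous
    (fun x y h => SemidirectProduct.inl_injective (congrArg Prod.snd h)) hproper.isClosedMap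

lemma embedsClosedNotOpen : EmbedsClosedNotOpen.{u}
    (SemidirectProduct (Multiplicative ℝ) FreeAbZ (realScaling (toUnits ℝ))) := by
  have h1 : IsLCGroup (SemidirectProduct (Multiplicative ℝ) FreeAbZ (realScaling (toUnits ℝ))) :=
    SemidirectProduct.isLCGroup isLCGroup_multiplicative_real .of_discreteTopology
      (continuous_realScaling continuous_of_discreteTopology)
  have : SecondCountableTopology (Multiplicative ℝ) :=
    inferInstanceAs (SecondCountableTopology ℝ)
  have h2 : SecondCountableTopology
      (SemidirectProduct (Multiplicative ℝ) FreeAbZ (realScaling (toUnits ℝ))) :=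
    (SemidirectProduct.homeomorphProd _).isEmbedding.secondCountableTopology
  have := h1.locallyCompactSpace
  refine ⟨h1, h2, inferInstance, ?_, fun G _ _ hG hGc => ?_⟩
  -- Only the real factor acts, through the exponential; the wreath factor acts trivially and serves
  -- to keep `Γ` closed and discrete.
  · let χ : Multiplicative ℝ × Wreath →* ℝˣ := expUnits.comp (MonoidHom.fst _ _)
    refine ⟨SemidirectProduct (Multiplicative ℝ) (Multiplicative ℝ × Wreath) (realScaling χ),
      inferInstance, inferInstance, ?_, ?_, ?_⟩
    · exact SemidirectProduct.isLCGroup isLCGroup_multiplicative_real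
        (isLCGroup_multiplicative_real.prod .of_discreteTopology)
        (continuous_realScaling (continuous_expUnits.comp continuous_fst))
    · refine SemidirectProduct.isCompactlyGeneratedGroup
        isCompactlyGeneratedGroup_multiplicative_real
        (isCompactlyGeneratedGroup_multiplicative_real.prod ?_)
      obtain ⟨S, hS⟩ := Group.fg_iff.1 wreath_fg
      exact ⟨S, hS.2.isCompact, hS.1⟩
    · exact .of_isClosedEmbedding _ (SemidirectProduct.isClosedEmbedding_map
        (i := MonoidHom.id _) .id isClosedEmbedding_diag fun γ => by
          refine MonoidHom.ext fun x => ?_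
          change Multiplicative.ofAdd ((toUnits ℝ γ : ℝ) * x.toAdd) =
            Multiplicative.ofAdd ((expUnits (log γ) : ℝ) * x.toAdd)
          rw [expUnits_log])
  · refine not_isIsoToOpenSubgroup (F := ℝ) Multiplicative.ofAdd univ_mem
      Multiplicative.ofAdd.injective.injOn (toUnits ℝ) (toUnits_injective ℝ) not_fg
      (fun γ => .of_forall fun x => rfl)
      (exists_conj_line _ continuous_ofAdd (fun x y => rfl) fun M hM hadd => ?_) G hG hGc
    let A : ℝ →+ ℝ := AddMonoidHom.mk' (fun x => (M x).toAdd) fun x y => by rw [hadd]; rfl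
    refine ⟨A 1, fun x => ?_⟩
    have := map_real_smul A (continuous_toAdd.comp hM) x 1
    rw [smul_eq_mul, smul_eq_mul, mul_one, mul_comm] at this
    exact congrArg Multiplicative.ofAdd this

end FreeAbZ

/-! ### The Lie group structure on `ℝ ⋊ Λ` -/

namespace SemidirectProduct

variable {Λ : Type} [CommGroup Λ] [TopologicalSpace Λ] [DiscreteTopology Λ] (χ : Λ →* ℝˣ)

/-- The chart of `ℝ ⋊ Λ` on the sheet with second coordinate `a`. -/
def sheet (a : Λ) :
    OpenPartialHomeomorph (SemidirectProduct (Multiplicative ℝ) Λ (realScaling χ)) ℝ where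
  toFun h := h.left.toAdd
  invFun x := ⟨Multiplicative.ofAdd x, a⟩
  source := {h | h.right = a}
  target := Set.univ
  map_source' _ _ := trivial
  map_target' _ _ := rfl
  left_inv' _ hh := SemidirectProduct.ext rfl hh.symm
  right_inv' _ _ := rfl
  open_source := (isOpen_discrete {a}).preimage continuous_right
  open_target := isOpen_univ
  continuousOn_toFun := (continuous_toAdd.comp continuous_left).continuousOn
  continuousOn_invFun :=
    (show Continuous fun x : ℝ =>
        (⟨Multiplicative.ofAdd x, a⟩ : SemidirectProduct _ Λ (realScaling χ)) from
      continuous_of_left_right continuous_ofAdd continuous_const).continuousOn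

instance chartedSpaceReal :
    ChartedSpace ℝ (SemidirectProduct (Multiplicative ℝ) Λ (realScaling χ)) where
  atlas := Set.range (sheet χ)
  chartAt h := sheet χ h.right
  mem_chart_source h := show h.right = h.right from rfl
  chart_mem_atlas _ := ⟨_, rfl⟩

instance isManifold_real :
    IsManifold 𝓘(ℝ, ℝ) ∞ (SemidirectProduct (Multiplicative ℝ) Λ (realScaling χ)) := by
  refine isManifold_of_contDiffOn _ _ _ ?_
  rintro _ _ ⟨a, rfl⟩ ⟨b, rfl⟩
  -- Every transition map is the identity on its domain, which is empty for distinct sheets.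
  exact contDiffOn_id (𝕜 := ℝ) (E := ℝ) (n := ∞)

variable {χ}

lemma coe_extChartAt_real (h : SemidirectProduct (Multiplicative ℝ) Λ (realScaling χ)) :
    (extChartAt 𝓘(ℝ, ℝ) h : SemidirectProduct (Multiplicative ℝ) Λ (realScaling χ) → ℝ) =
      fun x => x.left.toAdd :=
  rfl

lemma contMDiff_left : ContMDiff 𝓘(ℝ, ℝ) 𝓘(ℝ, ℝ) ∞
    fun h : SemidirectProduct (Multiplicative ℝ) Λ (realScaling χ) => h.left.toAdd :=
  fun h => by
  have := contMDiffAt_extChartAt (I := 𝓘(ℝ, ℝ)) (n := ∞) (x := h)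
  rwa [coe_extChartAt_real] at this

lemma contMDiff_of_left {E H M : Type*} [NormedAddCommGroup E] [NormedSpace ℝ E]
    [TopologicalSpace H] {I : ModelWithCorners ℝ E H} [TopologicalSpace M] [ChartedSpace H M]
    {f : M → SemidirectProduct (Multiplicative ℝ) Λ (realScaling χ)} (hf : Continuous f)
    (hl : ContMDiff I 𝓘(ℝ, ℝ) ∞ fun x => (f x).left.toAdd) : ContMDiff I 𝓘(ℝ, ℝ) ∞ f :=
  fun x => contMDiffAt_iff_target.2 ⟨hf.continuousAt, by
    rw [coe_extChartAt_real]
    exact hl x⟩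

/-- Functions of the discrete coordinate are locally constant; this handles the scaling factors in
multiplication and inversion. -/
lemma contMDiff_comp_right (c : Λ → ℝ) : ContMDiff 𝓘(ℝ, ℝ) 𝓘(ℝ, ℝ) ∞
    fun h : SemidirectProduct (Multiplicative ℝ) Λ (realScaling χ) => c h.right := fun h => by
  refine (contMDiffAt_const (c := c h.right)).congr_of_eventuallyEq ?_
  filter_upwards [((isOpen_discrete {h.right}).preimage continuous_right).mem_nhds rfl]
    with x hx
  rw [show x.right = h.right from hx]

variable (χ)

lemma isRealLieGroup :
    IsRealLieGroup (SemidirectProduct (Multiplicative ℝ) Λ (realScaling χ)) := by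
  have : IsTopologicalGroup (SemidirectProduct (Multiplicative ℝ) Λ (realScaling χ)) :=
    isTopologicalGroup (continuous_realScaling continuous_of_discreteTopology)
  refine ⟨ℝ, inferInstance, inferInstance, inferInstance, chartedSpaceReal χ, ?_⟩
  exact
    { isManifold_real χ with
      contMDiff_mul := contMDiff_of_left continuous_mul <|
        (contMDiff_left.comp contMDiff_fst).add <|
          ((contMDiff_comp_right fun a => (χ a : ℝ)).comp contMDiff_fst).mul
            (contMDiff_left.comp contMDiff_snd)
      contMDiff_inv := contMDiff_of_left continuous_inv <|
        (contMDiff_comp_right fun a => (χ a⁻¹ : ℝ)).mul contMDiff_left.neg }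

end SemidirectProduct

theorem theorem1p4 :
    -- the main assertion
    (∃ (H : Type) (_ : Group H) (_ : TopologicalSpace H), EmbedsClosedNotOpen.{u} H) ∧
    -- `H = K ⋊ Γ` with `K` compact connected abelian and `Γ` discrete abelian
    (∃ (K Γ : Type) (_ : CommGroup K) (_ : TopologicalSpace K)
      (_ : CommGroup Γ) (_ : TopologicalSpace Γ) (φ : Γ →* MulAut K),
      IsTopologicalGroup K ∧ T2Space K ∧ CompactSpace K ∧ ConnectedSpace K ∧
      DiscreteTopology Γ ∧ EmbedsClosedNotOpen.{u} (SemidirectProduct K Γ φ)) ∧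
    -- `H = K ⋊ Γ` with `K` profinite abelian and `Γ` discrete abelian
    (∃ (K Γ : Type) (_ : CommGroup K) (_ : TopologicalSpace K)
      (_ : CommGroup Γ) (_ : TopologicalSpace Γ) (φ : Γ →* MulAut K),
      IsTopologicalGroup K ∧ T2Space K ∧ CompactSpace K ∧ TotallyDisconnectedSpace K ∧
      DiscreteTopology Γ ∧ EmbedsClosedNotOpen.{u} (SemidirectProduct K Γ φ)) ∧
    -- `H = ℝ ⋊ Λ`, a Lie group, with `Λ` a subgroup of `ℝˣ` made discrete, acting by multiplication
    (∃ (Λ : Type) (_ : CommGroup Λ) (_ : TopologicalSpace Λ) (χ : Λ →* ℝˣ),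
      DiscreteTopology Λ ∧ Function.Injective χ ∧
      IsRealLieGroup (SemidirectProduct (Multiplicative ℝ) Λ (realScaling χ)) ∧
      EmbedsClosedNotOpen.{u} (SemidirectProduct (Multiplicative ℝ) Λ (realScaling χ))) := by
  exact ⟨⟨_, _, _, FreeAbZ.embedsClosedNotOpen⟩,
    ⟨Solenoid, FreeAbZ, inferInstance, inferInstance, inferInstance, inferInstance, _,
      inferInstance, inferInstance, inferInstance, inferInstance, inferInstance,
      Solenoid.embedsClosedNotOpen⟩,
    ⟨Multiplicative ℤ_[2], FreeAbZ, inferInstance, inferInstance, inferInstance, inferInstance, _,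
      inferInstance, inferInstance, inferInstance,
      inferInstanceAs (TotallyDisconnectedSpace ℤ_[2]), inferInstance,
      PadicInt.embedsClosedNotOpen⟩,
    ⟨FreeAbZ, inferInstance, inferInstance, FreeAbZ.toUnits ℝ, inferInstance,
      FreeAbZ.toUnits_injective ℝ, SemidirectProduct.isRealLieGroup _,
      FreeAbZ.embedsClosedNotOpen⟩⟩
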